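/- Let $X$ be a crowded (i.e. without isolated points), countably compact (every countable open cover has a finite subcover) Hausdorff space in which the regular closed sets form a $\pi$-network, that is, every nonempty open subset of $X$ includes a nonempty set $F$ with $F=\overline{\operatorname{int}F}$. Then $X$ is $\omega_1$-resolvable, i.e. there is a family $(D_\alpha)_{\alpha<\omega_1}$ of pairwise disjoint dense subsets of $X$. In particular, every crowded, countably compact $T_3$ space (regular and $T_1$) is $\omega_1$-resolvable. -/

import Mathlib

universe u

/-- A set is regular closed if it is the closure of its interior. -/
def IsRegularClosed {X : Type u} [TopologicalSpace X] (F : Set X) : Prop :=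
  closure (interior F) = F

/-- The nonempty members of the family `N` form a `π`-network of the space `X`: every nonempty
open set of `X` includes a nonempty member of `N`. The members of `N` need not be open. -/
def IsPiNetwork {X : Type u} [TopologicalSpace X] (N : Set (Set X)) : Prop :=
  ∀ U : Set X, IsOpen U → U.Nonempty → ∃ F ∈ N, F.Nonempty ∧ F ⊆ U

/-- The space `X` is `κ`-resolvable: it contains `κ` many pairwise disjoint dense subsets
(listed by an index type of cardinality `κ`). -/
def IsResolvable (κ : Cardinal.{u}) (X : Type u) [TopologicalSpace X] : Prop :=
  ∃ (ι : Type u) (D : ι → Set X), Cardinal.mk ι = κ ∧ (∀ i, Dense (D i)) ∧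
    ∀ i j, i ≠ j → Disjoint (D i) (D j)

/-! Let `E'` be `separatedDerivedSet E`. Iterating it from `X` gives a decreasing `ω₁`-sequence `E
a` of dense sets: cluster points of separated sequences exist by countable compactness and stay in a
prescribed open set by `π`-regularity. Inside a small open set there are two cases. If all
differences `E a \ (E a)'` are dense there, they are `ω₁` many disjoint dense sets. Otherwise some
nonempty `E = V ∩ E a` satisfies `E ⊆ E'`, which yields an `ω`-branching tree of points in which the
children of a node cluster at it. Distinct branches have distinct cluster points, and a
Bernstein-type colouring of the branches makes every colour `θ`-dense
(`exists_isThetaResolvable_of_subset_separatedDerivedSet`). `π`-regularity turns `θ`-density into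
density, and Zorn's lemma glues the local pieces. -/

section SelectionAndColouring

open Cardinal Filter

/-! ### Bernstein-type colouring of the branches of `ω^{<ω}` -/

/-- A family of sets, each at least as large as the index set, has an injective choice function. -/
theorem exists_injective_choice {K β : Type u} (B : K → Set β) (hB : ∀ k, #K ≤ #(B k)) :
    ∃ φ : K → β, Function.Injective φ ∧ ∀ k, φ k ∈ B k := by
  -- In the order type of the initial ordinal, fewer than `#K` choices precede each stage, so they
  -- cannot exhaust `B`.
  obtain ⟨e⟩ : Nonempty (K ≃ (#K).ord.ToType) := Cardinal.eq.1 (mk_ord_toType _).symm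
  have step : ∀ (k : (#K).ord.ToType) (ψ : ∀ j, j < k → β),
      ∃ b ∈ B (e.symm k), ∀ j (hj : j < k), b ≠ ψ j hj := by
    intro k ψ
    by_contra! hcon
    have hsub : B (e.symm k) ⊆ Set.range fun j : Set.Iio k ↦ ψ j.1 j.2 := by
      intro b hb
      obtain ⟨j, hj, rfl⟩ := hcon b hb
      exact ⟨⟨j, hj⟩, rfl⟩
    exact ((hB _).trans ((mk_le_mk_of_subset hsub).trans mk_range_le)).not_gt
      ((mk_Iio_lt k (by simp)).trans_eq (mk_ord_toType _))
  choose pick hpick hne using step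
  let φ : (#K).ord.ToType → β := WellFoundedLT.fix pick
  have hφ : ∀ k, φ k = pick k fun j _ ↦ φ j := fun k ↦ WellFoundedLT.fix_eq pick k
  have hlt : ∀ j k, j < k → φ k ≠ φ j := fun j k hjk ↦ by
    rw [hφ k]
    exact hne k _ j hjk
  refine ⟨φ ∘ e, Function.Injective.comp (fun j k hjk ↦ ?_) e.injective, fun k ↦ ?_⟩
  · rcases lt_trichotomy j k with h | h | h
    · exact absurd hjk.symm (hlt _ _ h)
    · exact h
    · exact absurd hjk (hlt _ _ h)
  · have := hpick (e k) fun j _ ↦ φ j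
    rw [← hφ, e.symm_apply_apply] at this
    exact this

/-- The initial segment of length `n` of a sequence, listed backwards. -/
def initialSegment (f : ℕ → ℕ) : ℕ → List ℕ
  | 0 => []
  | n + 1 => f n :: initialSegment f n

theorem initialSegment_congr {f g : ℕ → ℕ} {n : ℕ} (h : ∀ m < n, f m = g m) :
    initialSegment f n = initialSegment g n := by
  induction n with
  | zero => rfl
  | succ n ih =>
    simp only [initialSegment]
    rw [h n n.lt_succ_self, ih fun m hm ↦ h m (hm.trans n.lt_succ_self)]

theorem exists_initialSegment_eq (s : List ℕ) : ∃ f, initialSegment f s.length = s := by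
  induction s with
  | nil => exact ⟨0, rfl⟩
  | cons a s ih =>
    obtain ⟨f, hf⟩ := ih
    refine ⟨Function.update f s.length a, ?_⟩
    simp only [List.length_cons, initialSegment, Function.update_self]
    rw [initialSegment_congr (g := f) fun m hm ↦ Function.update_of_ne hm.ne _ _, hf]

/-- The branches that eventually stay in a nonempty, infinitely branching part of the tree of
finite sequences are continuum many. -/
theorem continuum_le_mk_branches {G : Set (List ℕ)}
    (hG : ∀ s ∈ G, ∃ᶠ n in atTop, n :: s ∈ G) (hne : G.Nonempty) :
    𝔠 ≤ #{f : ℕ → ℕ | ∀ᶠ n in atTop, initialSegment f n ∈ G} := by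
  obtain ⟨s₀, hs₀⟩ := hne
  obtain ⟨f₀, hf₀⟩ := exists_initialSegment_eq s₀
  set N := s₀.length
  have hinf : ∀ s ∈ G, (Set.ofPred fun n ↦ n :: s ∈ G).Infinite := fun s hs ↦
    Nat.frequently_atTop_iff_infinite.1 (hG s hs)
  -- Follow `s₀` up to its length `N`; from then on `h` says which of the infinitely many children
  -- in `G` to take, so `h` is recoverable from the branch.
  let next (h : ℕ → ℕ) (n : ℕ) (s : List ℕ) : ℕ :=
    if n < N then f₀ n else Nat.nth (fun m ↦ m :: s ∈ G) (h (n - N))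
  let st (h : ℕ → ℕ) (n : ℕ) : List ℕ := Nat.rec [] (fun n s ↦ next h n s :: s) n
  let Φ (h : ℕ → ℕ) (n : ℕ) : ℕ := next h n (st h n)
  have hst : ∀ h n, initialSegment (Φ h) n = st h n := by
    intro h n
    induction n with
    | zero => rfl
    | succ n ih => simp only [initialSegment, ih]; rfl
  have hmem : ∀ h n, N ≤ n → st h n ∈ G := by
    intro h n hn
    induction n, hn using Nat.le_induction with
    | base =>
      have : initialSegment (Φ h) N = initialSegment f₀ N :=
        initialSegment_congr fun m hm ↦ by simp only [Φ, next, if_pos hm]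
      rw [← hst, this, hf₀]
      exact hs₀
    | succ n hn ih =>
      change next h n (st h n) :: st h n ∈ G
      simp only [next, if_neg hn.not_gt]
      exact Nat.nth_mem_of_infinite (hinf _ ih) _
  have hΦ : Function.Injective Φ := by
    intro h h' heq
    funext n
    have h1 := congrFun heq (N + n)
    have h2 : st h (N + n) = st h' (N + n) := by rw [← hst, ← hst, heq]
    simp only [Φ, next, if_neg (Nat.le_add_right N n).not_gt, h2, Nat.add_sub_cancel_left] at h1
    exact Nat.nth_injective (hinf _ (hmem h' _ (Nat.le_add_right N n))) h1
  have hcard : 𝔠 = #(ℕ → ℕ) := by simp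
  rw [hcard]
  refine mk_le_of_injective (f := fun h ↦ ⟨Φ h, ?_⟩) fun h h' heq ↦ hΦ (congrArg Subtype.val heq)
  exact eventually_atTop.2 ⟨N, fun n hn ↦ by rw [hst]; exact hmem h n hn⟩

/-- The Baire space has continuum many pairwise disjoint subsets each of which meets the set of
branches of every infinitely branching part of the tree of finite sequences. -/
theorem exists_disjoint_branch_sets :
    ∃ C : Set ℕ → Set (ℕ → ℕ), Pairwise (fun i j ↦ Disjoint (C i) (C j)) ∧
      ∀ G : Set (List ℕ), (∀ s ∈ G, ∃ᶠ n in atTop, n :: s ∈ G) → G.Nonempty →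
        ∀ i, ∃ f ∈ C i, ∀ᶠ n in atTop, initialSegment f n ∈ G := by
  let br (G : Set (List ℕ)) : Set (ℕ → ℕ) := {f | ∀ᶠ n in atTop, initialSegment f n ∈ G}
  -- As `List ℕ` is countable, there are at most `𝔠` pairs of a subset `G` and a colour, while each
  -- `br G` considered has at least `𝔠` branches.
  have hK : #({G : Set (List ℕ) // 𝔠 ≤ #(br G)} × Set ℕ) ≤ 𝔠 := by
    have h1 : #{G : Set (List ℕ) // 𝔠 ≤ #(br G)} ≤ 𝔠 := (mk_subtype_le _).trans (by simp)
    have h2 : #(Set ℕ) ≤ 𝔠 := by simp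
    rw [mk_prod, lift_id, lift_id]
    exact (mul_le_mul' h1 h2).trans (by simp)
  obtain ⟨φ, hφ, hmem⟩ := exists_injective_choice
    (fun k : {G : Set (List ℕ) // 𝔠 ≤ #(br G)} × Set ℕ ↦ br k.1.1) fun k ↦ hK.trans k.1.2
  refine ⟨fun i ↦ Set.range fun G ↦ φ (G, i), fun i j hij ↦ ?_, fun G hG hne i ↦ ?_⟩
  · refine Set.disjoint_left.2 ?_
    rintro _ ⟨G, rfl⟩ ⟨G', h⟩
    exact hij (congrArg Prod.snd (hφ h)).symm
  · exact ⟨_, ⟨⟨G, continuum_le_mk_branches hG hne⟩, rfl⟩, hmem (⟨G, _⟩, i)⟩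

end SelectionAndColouring

section Topology

open Cardinal Filter Topology

/-! ### Separated sequences and their cluster points -/

/-- Every nonempty open set includes the closure of a nonempty open set. -/
def IsPiRegular (X : Type u) [TopologicalSpace X] : Prop :=
  ∀ U : Set X, IsOpen U → U.Nonempty → ∃ V : Set X, IsOpen V ∧ V.Nonempty ∧ closure V ⊆ U

theorem IsPiNetwork.isPiRegular {X : Type u} [TopologicalSpace X]
    (h : IsPiNetwork {F : Set X | IsRegularClosed F}) : IsPiRegular X := by
  intro U hU hne
  obtain ⟨F, hF, hFne, hFU⟩ := h U hU hne
  have hF' : closure (interior F) = F := hF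
  exact ⟨interior F, isOpen_interior, closure_nonempty_iff.1 (by rwa [hF']), by rwa [hF']⟩

theorem isPiNetwork_isRegularClosed (X : Type u) [TopologicalSpace X] [RegularSpace X] :
    IsPiNetwork {F : Set X | IsRegularClosed F} := by
  rintro U hU ⟨x, hx⟩
  obtain ⟨F, hF, hFc, hFU⟩ := exists_mem_nhds_isClosed_subset (hU.mem_nhds hx)
  refine ⟨closure (interior F), ?_, ⟨x, subset_closure (mem_interior_iff_mem_nhds.2 hF)⟩,
    (hFc.closure_interior_subset).trans hFU⟩
  exact closure_interior_idem

/-- The points that are cluster points of a sequence of points of `E` with open neighbourhoods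
whose closures are pairwise disjoint. -/
def separatedDerivedSet {X : Type u} [TopologicalSpace X] (E : Set X) : Set X :=
  {x | ∃ (p : ℕ → X) (W : ℕ → Set X), (∀ n, IsOpen (W n)) ∧ (∀ n, p n ∈ W n) ∧ (∀ n, p n ∈ E) ∧
    Pairwise (fun m n ↦ Disjoint (closure (W m)) (closure (W n))) ∧ MapClusterPt x atTop p}

/-- A set `Y` carries a family of `ι` pairwise disjoint subsets that all meet the closure of every
open set that meets `Y`. -/
def IsThetaResolvable {X : Type u} [TopologicalSpace X] (ι : Type u) (Y : Set X) : Prop :=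
  ∃ D : ι → Set X, (∀ i, D i ⊆ Y) ∧ Pairwise (fun i j ↦ Disjoint (D i) (D j)) ∧
    ∀ i, ∀ O : Set X, IsOpen O → (O ∩ Y).Nonempty → (closure O ∩ D i).Nonempty

variable {X : Type u} [TopologicalSpace X]

/-- Passing to a subsequence, the sequence and its neighbourhoods can be put into any given
neighbourhood of the cluster point. -/
theorem exists_separated_sequence_subset {E O : Set X} {x : X} (hx : x ∈ separatedDerivedSet E)
    (hO : IsOpen O) (hxO : x ∈ O) :
    ∃ (p : ℕ → X) (W : ℕ → Set X), (∀ n, IsOpen (W n)) ∧ (∀ n, p n ∈ W n) ∧ (∀ n, p n ∈ E) ∧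
      Pairwise (fun m n ↦ Disjoint (closure (W m)) (closure (W n))) ∧ (∀ n, W n ⊆ O) ∧
      MapClusterPt x atTop p := by
  obtain ⟨p, W, hW, hpW, hpE, hdis, hclu⟩ := hx
  have hinf : (Set.ofPred fun n ↦ p n ∈ O).Infinite :=
    Nat.frequently_atTop_iff_infinite.1 (mapClusterPt_iff_frequently.1 hclu O (hO.mem_nhds hxO))
  have hinj := Nat.nth_injective hinf
  have hmem : ∀ n, p (Nat.nth (fun n ↦ p n ∈ O) n) ∈ O := Nat.nth_mem_of_infinite hinf
  refine ⟨fun n ↦ p (Nat.nth (fun n ↦ p n ∈ O) n), fun n ↦ W (Nat.nth (fun n ↦ p n ∈ O) n) ∩ O,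
    fun n ↦ (hW _).inter hO, fun n ↦ ⟨hpW _, hmem n⟩, fun n ↦ hpE _, fun m n hmn ↦ ?_,
    fun n ↦ Set.inter_subset_right, mapClusterPt_iff_frequently.2 fun V hV ↦ ?_⟩
  · exact (hdis (hinj.ne hmn)).mono (closure_mono Set.inter_subset_left)
      (closure_mono Set.inter_subset_left)
  · have hinf' := Nat.frequently_atTop_iff_infinite.1
      (mapClusterPt_iff_frequently.1 hclu (V ∩ O) (inter_mem hV (hO.mem_nhds hxO)))
    refine Nat.frequently_atTop_iff_infinite.2 fun hfin ↦ hinf' ?_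
    -- Every index with `p n ∈ V ∩ O` is enumerated by the subsequence, so finitely many visits of
    -- the subsequence to `V` would leave finitely many such indices.
    refine (hfin.image (Nat.nth fun n ↦ p n ∈ O)).subset fun n hn ↦ ?_
    have hn' : n ∈ Set.range (Nat.nth fun n ↦ p n ∈ O) := by
      rw [Nat.range_nth_of_infinite hinf]
      exact hn.2
    obtain ⟨m, rfl⟩ := hn'
    exact ⟨m, hn.1, rfl⟩

theorem exists_mapClusterPt [CountablyCompactSpace X] (p : ℕ → X) :
    ∃ x, MapClusterPt x atTop p := by
  obtain ⟨x, -, hx⟩ := CountablyCompactSpace.isCountablyCompact_univ.seq_clusterPt p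
    (Eventually.of_forall fun _ ↦ Set.mem_univ _)
  exact ⟨x, hx⟩

theorem mem_closure_of_mapClusterPt {A : Set X} {x : X} {p : ℕ → X} (hx : MapClusterPt x atTop p)
    (hp : ∀ᶠ n in atTop, p n ∈ A) : x ∈ closure A := by
  refine mem_closure_iff_nhds.2 fun V hV ↦ ?_
  obtain ⟨n, hn, hn'⟩ := ((mapClusterPt_iff_frequently.1 hx V hV).and_eventually hp).exists
  exact ⟨p n, hn, hn'⟩

theorem exists_open_sequence_disjoint_closures [T2Space X] [PerfectSpace X] (hX : IsPiRegular X)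
    {U : Set X} (hU : IsOpen U) (hne : U.Nonempty) :
    ∃ W : ℕ → Set X, (∀ n, IsOpen (W n)) ∧ (∀ n, (W n).Nonempty) ∧ (∀ n, W n ⊆ U) ∧
      Pairwise fun m n ↦ Disjoint (closure (W m)) (closure (W n)) := by
  obtain ⟨x, hx⟩ := hne
  have : NeBot (𝓝[≠] x) := by
    have := PerfectSpace.univ_preperfect (α := X) x (Set.mem_univ x)
    simpa [AccPt] using this
  have : Infinite U := (infinite_of_mem_nhds x (hU.mem_nhds hx)).to_subtype
  obtain ⟨V, hVinf, hV, hVd⟩ := exists_seq_infinite_isOpen_pairwise_disjoint U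
  have hVne : ∀ n, ((↑) '' V n : Set X).Nonempty := fun n ↦ by
    exact (hVinf n).nonempty.image _
  choose W hW hWne hWV using fun n ↦ hX _ (hU.isOpenMap_subtype_val _ (hV n)) (hVne n)
  refine ⟨W, hW, hWne, fun n ↦ (subset_closure.trans (hWV n)).trans ?_, fun m n hmn ↦ ?_⟩
  · exact Subtype.coe_image_subset _ _
  · exact (Set.disjoint_image_of_injective Subtype.val_injective (hVd hmn)).mono (hWV m) (hWV n)

theorem exists_separated_cluster_point [T2Space X] [PerfectSpace X] [CountablyCompactSpace X]
    (hX : IsPiRegular X) {A : ℕ → Set X} (hA : ∀ n, Dense (A n)) {U : Set X} (hU : IsOpen U)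
    (hne : U.Nonempty) :
    ∃ x ∈ U, ∃ (p : ℕ → X) (W : ℕ → Set X), (∀ n, IsOpen (W n)) ∧ (∀ n, p n ∈ W n) ∧
      (∀ n, p n ∈ A n) ∧ Pairwise (fun m n ↦ Disjoint (closure (W m)) (closure (W n))) ∧
      MapClusterPt x atTop p := by
  obtain ⟨V, hV, hVne, hVU⟩ := hX U hU hne
  obtain ⟨W, hW, hWne, hWV, hdis⟩ := exists_open_sequence_disjoint_closures hX hV hVne
  choose p hpW hpA using fun n ↦ (hA n).inter_open_nonempty (W n) (hW n) (hWne n)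
  obtain ⟨x, hx⟩ := exists_mapClusterPt p
  exact ⟨x, hVU (mem_closure_of_mapClusterPt hx (Eventually.of_forall fun n ↦ hWV n (hpW n))),
    p, W, hW, hpW, hpA, hdis, hx⟩

/-! ### The iterated derived sets are dense -/

/-- The transfinite iteration of `separatedDerivedSet` along a well-order, starting from the whole
space. -/
noncomputable def iteratedSeparatedDerivedSet (X : Type u) [TopologicalSpace X] {J : Type u}
    [LinearOrder J] [WellFoundedLT J] : J → Set X :=
  WellFoundedLT.fix fun a E ↦ {x | ∀ b, ∀ h : b < a, x ∈ separatedDerivedSet (E b h)}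

section Iterated

variable {J : Type u} [LinearOrder J] [WellFoundedLT J]

theorem mem_iteratedSeparatedDerivedSet {a : J} {x : X} :
    x ∈ iteratedSeparatedDerivedSet X a ↔
      ∀ b < a, x ∈ separatedDerivedSet (iteratedSeparatedDerivedSet X b) := by
  rw [iteratedSeparatedDerivedSet, WellFoundedLT.fix_eq]
  rfl

theorem iteratedSeparatedDerivedSet_antitone :
    Antitone (iteratedSeparatedDerivedSet X : J → Set X) := fun _ _ hab _ hx ↦
  mem_iteratedSeparatedDerivedSet.2 fun c hc ↦
    mem_iteratedSeparatedDerivedSet.1 hx c (hc.trans_le hab)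

theorem dense_iteratedSeparatedDerivedSet [T2Space X] [PerfectSpace X] [CountablyCompactSpace X]
    (hX : IsPiRegular X) (hJ : ∀ a : J, (Set.Iio a).Countable) (a : J) :
    Dense (iteratedSeparatedDerivedSet X a) := by
  induction a using WellFoundedLT.induction with
  | ind a ih =>
    refine dense_iff_inter_open.2 fun U hU hne ↦ ?_
    rcases (Set.Iio a).eq_empty_or_nonempty with h | h
    · obtain ⟨x, hx⟩ := hne
      refine ⟨x, hx, mem_iteratedSeparatedDerivedSet.2 fun b hb ↦ ?_⟩
      have : b ∈ Set.Iio a := hb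
      simp [h] at this
    obtain ⟨b, hb⟩ := (hJ a).exists_eq_range h
    -- Running maxima of an enumeration of the predecessors of `a`: since the sets decrease, a
    -- sequence with `p n` at level `m n` lies in the set of level `b k` from index `k` on, so one
    -- cluster point serves all levels below `a`.
    let m : ℕ → J := partialSups b
    have hm : ∀ n, m n < a := fun n ↦ by
      obtain ⟨k, -, hk⟩ := exists_partialSups_eq b n
      have : b k ∈ Set.Iio a := hb ▸ Set.mem_range_self k
      simp only [m, hk]
      exact this
    obtain ⟨x, hxU, p, W, hW, hpW, hpA, hdis, hx⟩ :=
      exists_separated_cluster_point hX (fun n ↦ ih (m n) (hm n)) hU hne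
    refine ⟨x, hxU, mem_iteratedSeparatedDerivedSet.2 fun c hc ↦ ?_⟩
    obtain ⟨k, rfl⟩ : c ∈ Set.range b := hb ▸ hc
    refine ⟨fun n ↦ p (n + k), fun n ↦ W (n + k), fun n ↦ hW _, fun n ↦ hpW _, fun n ↦ ?_,
      fun i j hij ↦ hdis fun h ↦ hij (Nat.add_right_cancel h), ?_⟩
    · exact iteratedSeparatedDerivedSet_antitone
        (le_partialSups_of_le b (Nat.le_add_left k n)) (hpA (n + k))
    · refine mapClusterPt_iff_frequently.2 fun V hV ↦ frequently_atTop.2 fun N ↦ ?_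
      obtain ⟨n, hn, hnV⟩ :=
        frequently_atTop.1 (mapClusterPt_iff_frequently.1 hx V hV) (N + k)
      refine ⟨n - k, by lia, ?_⟩
      rwa [Nat.sub_add_cancel (by lia)]

end Iterated

/-! ### Locally `θ`-resolvable sets: the tree and the dichotomy -/

/-- A nonempty set of cluster points of separated sequences from itself includes a tree whose
branches yield a `θ`-resolvable set. -/
theorem exists_isThetaResolvable_of_subset_separatedDerivedSet [CountablyCompactSpace X] {ι : Type u}
    (hι : lift.{0} #ι ≤ lift.{u} #(Set ℕ)) {E : Set X} (hE : E ⊆ separatedDerivedSet E)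
    (hne : E.Nonempty) : ∃ Y ⊆ closure E, Y.Nonempty ∧ IsThetaResolvable ι Y := by
  let Node := {v : X × Set X // v.1 ∈ E ∧ v.1 ∈ v.2 ∧ IsOpen v.2}
  have hchild : ∀ v : Node, ∃ c : ℕ → Node, (∀ n, (c n).1.2 ⊆ v.1.2) ∧
      Pairwise (fun m n ↦ Disjoint (closure (c m).1.2) (closure (c n).1.2)) ∧
      MapClusterPt v.1.1 atTop fun n ↦ (c n).1.1 := by
    rintro ⟨⟨x, O⟩, hxE, hxO, hO⟩
    obtain ⟨p, W, hW, hpW, hpE, hdis, hWO, hx⟩ :=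
      exists_separated_sequence_subset (hE hxE) hO hxO
    exact ⟨fun n ↦ ⟨(p n, W n), hpE n, hpW n, hW n⟩, hWO, hdis, hx⟩
  choose child hsub hdis hclu using hchild
  obtain ⟨x₀, hx₀⟩ := hne
  let node : List ℕ → Node := fun s ↦
    List.rec ⟨(x₀, Set.univ), hx₀, Set.mem_univ _, isOpen_univ⟩ (fun n _ v ↦ child v n) s
  have hnode : ∀ n s, node (n :: s) = child (node s) n := fun _ _ ↦ rfl
  let pt (s : List ℕ) : X := (node s).1.1
  let nbd (s : List ℕ) : Set X := (node s).1.2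
  have hanti : ∀ f, Antitone fun n ↦ nbd (initialSegment f n) := fun f ↦
    antitone_nat_of_succ_le fun n ↦ hsub (node (initialSegment f n)) (f n)
  choose y hy using fun f ↦ exists_mapClusterPt fun n ↦ pt (initialSegment f n)
  have hynbd : ∀ f n, y f ∈ closure (nbd (initialSegment f n)) := fun f n ↦
    mem_closure_of_mapClusterPt (hy f) (eventually_atTop.2
      ⟨n, fun m hm ↦ hanti f hm (node (initialSegment f m)).2.2.1⟩)
  have hyinj : Function.Injective y := by
    intro f g hfg
    by_contra hne
    have hex : ∃ n, f n ≠ g n := Function.ne_iff.1 hne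
    classical
    -- At the first difference the branches pass to distinct siblings, whose neighbourhoods have
    -- disjoint closures.
    have hn := Nat.find_spec hex
    have hseg : initialSegment f (Nat.find hex) = initialSegment g (Nat.find hex) :=
      initialSegment_congr fun m hm ↦ not_not.1 (Nat.find_min hex hm)
    have h1 := hynbd f (Nat.find hex + 1)
    have h2 := hynbd g (Nat.find hex + 1)
    simp only [nbd, initialSegment, hnode] at h1 h2
    rw [hseg] at h1
    rw [← hfg] at h2
    exact Set.disjoint_left.1 (hdis _ hn) h1 h2
  obtain ⟨C, hCdis, hC⟩ := exists_disjoint_branch_sets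
  obtain ⟨e⟩ := lift_mk_le'.1 hι
  refine ⟨closure (Set.range pt), closure_mono ?_, ⟨_, subset_closure ⟨[], rfl⟩⟩,
    fun i ↦ y '' C (e i), fun i ↦ ?_, fun i j hij ↦ ?_, fun i O hO hOY ↦ ?_⟩
  · rintro _ ⟨s, rfl⟩
    exact (node s).2.1
  · rintro _ ⟨f, -, rfl⟩
    exact mem_closure_of_mapClusterPt (hy f) (Eventually.of_forall fun n ↦ ⟨_, rfl⟩)
  · exact Set.disjoint_image_of_injective hyinj (hCdis (e.injective.ne hij))
  · obtain ⟨z, hzO, hz⟩ := hOY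
    obtain ⟨_, hsO, s, rfl⟩ := mem_closure_iff.1 hz O hO hzO
    -- The nodes with point in the open set `O` form an infinitely branching part, because children
    -- cluster at their parent. A branch eventually inside it has its cluster point only in `closure
    -- O`, whence the `θ` in the notion.
    obtain ⟨f, hf, hfO⟩ := hC {s | pt s ∈ O}
      (fun s hs ↦ mapClusterPt_iff_frequently.1 (hclu (node s)) O (hO.mem_nhds hs)) ⟨s, hsO⟩ (e i)
    exact ⟨y f, mem_closure_of_mapClusterPt (hy f) hfO, f, hf, rfl⟩

/-- The dichotomy: either the successive differences of the iteration are dense in an open `U'` and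
serve as the disjoint sets, or one of them misses some open `V`, and `V ∩ E a` supports the tree
construction. -/
theorem exists_isThetaResolvable_subset [T2Space X] [PerfectSpace X] [CountablyCompactSpace X]
    (hX : IsPiRegular X) {J : Type u} [LinearOrder J] [WellFoundedLT J]
    (hJ : ∀ a : J, (Set.Iio a).Countable) (hJc : lift.{0} #J ≤ lift.{u} #(Set ℕ)) {U : Set X}
    (hU : IsOpen U) (hne : U.Nonempty) : ∃ Y ⊆ U, Y.Nonempty ∧ IsThetaResolvable J Y := by
  obtain ⟨U', hU', hne', hUU'⟩ := hX U hU hne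
  let E : J → Set X := iteratedSeparatedDerivedSet X
  by_cases hcase : ∀ a, ∀ V ⊆ U', IsOpen V → V.Nonempty →
      (V ∩ (E a \ separatedDerivedSet (E a))).Nonempty
  · refine ⟨U', subset_closure.trans hUU', hne',
      fun a ↦ U' ∩ (E a \ separatedDerivedSet (E a)), fun a ↦ Set.inter_subset_left, ?_, ?_⟩
    · have hlt : ∀ a b, a < b → Disjoint (U' ∩ (E a \ separatedDerivedSet (E a)))
          (U' ∩ (E b \ separatedDerivedSet (E b))) := fun a b hab ↦
        Set.disjoint_left.2 fun x hxa hxb ↦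
          hxa.2.2 (mem_iteratedSeparatedDerivedSet.1 hxb.2.1 a hab)
      intro a b hab
      rcases lt_or_gt_of_ne hab with h | h
      · exact hlt a b h
      · exact (hlt b a h).symm
    · intro a O hO hOU
      obtain ⟨x, hx, hxE⟩ := hcase a (O ∩ U') Set.inter_subset_right (hO.inter hU') hOU
      exact ⟨x, subset_closure hx.1, hx.2, hxE⟩
  · push Not at hcase
    obtain ⟨a, V, hVU, hV, hVne, hemp⟩ := hcase
    have hsub : V ∩ E a ⊆ separatedDerivedSet (V ∩ E a) := by
      rintro x ⟨hxV, hxE⟩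
      have hx : x ∈ separatedDerivedSet (E a) := by
        by_contra h
        exact (Set.eq_empty_iff_forall_notMem.1 hemp x) ⟨hxV, hxE, h⟩
      obtain ⟨p, W, hW, hpW, hpE, hdis, hWV, hclu⟩ := exists_separated_sequence_subset hx hV hxV
      exact ⟨p, W, hW, hpW, fun n ↦ ⟨hWV n (hpW n), hpE n⟩, hdis, hclu⟩
    obtain ⟨Y, hY, hYne, hres⟩ := exists_isThetaResolvable_of_subset_separatedDerivedSet hJc hsub
      ((dense_iteratedSeparatedDerivedSet hX hJ a).inter_open_nonempty V hV hVne)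
    exact ⟨Y, hY.trans ((closure_mono (Set.inter_subset_left.trans hVU)).trans hUU'), hYne, hres⟩

/-! ### Gluing by maximality -/

/-- If every nonempty open subset of a `π`-regular space includes a nonempty `θ`-resolvable set,
then the space has `ι` many pairwise disjoint dense subsets. -/
theorem exists_disjoint_dense_of_isThetaResolvable (hX : IsPiRegular X) {ι : Type u}
    (h : ∀ U : Set X, IsOpen U → U.Nonempty → ∃ Y ⊆ U, Y.Nonempty ∧ IsThetaResolvable ι Y) :
    ∃ D : ι → Set X, (∀ i, Dense (D i)) ∧ ∀ i j, i ≠ j → Disjoint (D i) (D j) := by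
  obtain ⟨M, hM⟩ := zorn_subset
    {M : Set (Set X) | (∀ Y ∈ M, IsThetaResolvable ι Y) ∧ M.PairwiseDisjoint id} (by
      intro c hc hchain
      refine ⟨⋃₀ c, ⟨?_, ?_⟩, fun s hs ↦ Set.subset_sUnion_of_mem hs⟩
      · rintro Y ⟨s, hs, hY⟩
        exact (hc hs).1 Y hY
      · exact (Set.pairwiseDisjoint_sUnion hchain.directedOn).2 fun s hs ↦ (hc hs).2)
  have hdense : Dense (⋃₀ M) := by
    refine dense_iff_closure_eq.2 (by_contra fun hcl ↦ ?_)
    obtain ⟨Y, hYU, hYne, hY⟩ := h (closure (⋃₀ M))ᶜ isClosed_closure.isOpen_compl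
      (Set.nonempty_compl.2 hcl)
    have hdis : ∀ Z ∈ M, Disjoint Y Z := fun Z hZ ↦ Set.disjoint_left.2 fun y hy hyZ ↦
      hYU hy (subset_closure ⟨Z, hZ, hyZ⟩)
    have hYM : Y ∈ M := by
      -- Maximality forces `Y ∈ M`, but `Y` is disjoint from every member of `M`, hence from itself.
      refine hM.le_of_ge (y := insert Y M) ⟨?_, ?_⟩ (Set.subset_insert _ _) (Set.mem_insert _ _)
      · rintro Z (rfl | hZ)
        · exact hY
        · exact hM.prop.1 Z hZ
      · exact hM.prop.2.insert fun Z hZ _ ↦ hdis Z hZ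
    obtain ⟨y, hy⟩ := hYne
    exact Set.disjoint_left.1 (hdis Y hYM) hy hy
  choose D hDY hDdis hD using hM.prop.1
  refine ⟨fun i ↦ {x | ∃ Y, ∃ hY : Y ∈ M, x ∈ D Y hY i}, fun i ↦ ?_, fun i j hij ↦ ?_⟩
  · refine dense_iff_inter_open.2 fun U hU hne ↦ ?_
    -- Meeting `closure V` suffices to meet `U`, so `θ`-density becomes density.
    obtain ⟨V, hV, hVne, hVU⟩ := hX U hU hne
    obtain ⟨x, hxV, Y, hY, hxY⟩ := hdense.inter_open_nonempty V hV hVne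
    obtain ⟨z, hzV, hz⟩ := hD Y hY i V hV ⟨x, hxV, hxY⟩
    exact ⟨z, hVU hzV, Y, hY, hz⟩
  · refine Set.disjoint_left.2 ?_
    rintro x ⟨Y, hY, hx⟩ ⟨Z, hZ, hx'⟩
    obtain rfl : Y = Z := hM.prop.2.elim_set hY hZ x (hDY Y hY i hx) (hDY Z hZ j hx')
    exact Set.disjoint_left.1 (hDdis Y hY hij) hx hx'

theorem isResolvable_aleph_one [T2Space X] [PerfectSpace X] [CountablyCompactSpace X]
    (hX : IsPiRegular X) : IsResolvable (ℵ_ 1) X := by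
  have hJ : ∀ a : (ℵ_ (1 : Ordinal.{u})).ord.ToType, (Set.Iio a).Countable := fun a ↦ by
    have := ((mk_Iio_lt a (by simp)).trans_eq (mk_ord_toType _)).trans_eq succ_aleph0.symm
    exact le_aleph0_iff_set_countable.1 (Order.lt_succ_iff.1 this)
  have hJc : lift.{0} #(ℵ_ (1 : Ordinal.{u})).ord.ToType ≤ lift.{u} #(Set ℕ) := by
    simpa using aleph_one_le_continuum
  obtain ⟨D, hD, hdis⟩ := exists_disjoint_dense_of_isThetaResolvable hX fun U hU hne ↦
    exists_isThetaResolvable_subset hX hJ hJc hU hne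
  exact ⟨_, D, mk_ord_toType _, hD, hdis⟩

end Topology

theorem mainTheorem4 :
    (∀ (X : Type u) [TopologicalSpace X] [T2Space X] [PerfectSpace X] [CountablyCompactSpace X],
      IsPiNetwork {F : Set X | IsRegularClosed F} → IsResolvable (Cardinal.aleph 1) X) ∧
    (∀ (X : Type u) [TopologicalSpace X] [T3Space X] [PerfectSpace X] [CountablyCompactSpace X],
      IsResolvable (Cardinal.aleph 1) X) :=
  ⟨fun _ _ _ _ _ h ↦ isResolvable_aleph_one h.isPiRegular,
    fun X _ _ _ _ ↦ isResolvable_aleph_one (isPiNetwork_isRegularClosed X).isPiRegular⟩
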